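/- Let $(X,\Delta^\vee,\Lambda,\Delta)$ be a reduced root datum, with character lattice $X$, finite set of roots $\Delta^\vee\subset X$, cocharacter (coweight) lattice $\Lambda$, finite set of coroots $\Delta\subset\Lambda$ and perfect pairing $\langle\cdot,\cdot\rangle\colon X\times\Lambda\to\mathbb Z$, together with a choice of simple roots and hence of positive roots $\Delta^\vee_+$ (for example, the root datum of a connected reductive complex algebraic group $G$ with a maximal torus $T$ and a Borel subgroup $B\supset T$). Let $W$ be its Weyl group. A coweight $\lambda\in\Lambda$ is dominant if $\langle\alpha^\vee,\lambda\rangle\ge 0$ for all $\alpha^\vee\in\Delta^\vee_+$; write $\Lambda^+$ for the set of dominant coweights. For $\mu,\lambda\in\Lambda$ write $\mu\le\lambda$ if $\lambda-\mu$ is a sum of simple coroots with non-negative integer coefficients. For $\mu\in\Lambda$ let $\mu^+$ be the dominant representative of the orbit $W\mu$. For every coweight $\mu\in\Lambda$ the following two conditions are equivalent: (1) $\langle\alpha^\vee,\mu\rangle\ge -1$ for every positive root $\alpha^\vee\in\Delta^\vee_+$; (2) for every dominant coweight $\lambda'\in\Lambda^+$, if $\mu\le\lambda'\le\mu^+$ then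 $\lambda'=\mu^+$ (that is, no dominant $\lambda'$ satisfies $\mu\le\lambda'<\mu^+$). -/

import Mathlib

namespace RootDatum

variable {ι X Y : Type*} [AddCommGroup X] [AddCommGroup Y] {P : RootDatum ι X Y}

/-- A coweight is dominant if it pairs non-negatively with every positive root. -/
def IsDominant (b : P.Base) (lam : Y) : Prop :=
  ∀ i, b.IsPos i → 0 ≤ P.toLinearMap (P.root i) lam

/-- The dominance order `mu ≤ lam` on coweights: `lam - mu` is a sum of simple coroots. -/
def DominanceLE (b : P.Base) (mu lam : Y) : Prop :=
  lam - mu ∈ AddSubmonoid.closure (P.coroot '' b.support)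

/-- The orbit of a coweight under the Weyl group. Mathlib's action of the Weyl group on
coweights is a right action, hence `op`; the set of transformations of `Y` is the group generated
by the coreflections `y ↦ y - ⟨α, y⟩ α^∨`. -/
def weylOrbit (P : RootDatum ι X Y) (mu : Y) : Set Y :=
  MulAction.orbit P.weylGroup.op mu

lemma pairing_op_smul (g : P.Aut) (i : ι) (mu : Y) :
    P.toLinearMap (P.root i) (MulOpposite.op g • mu) = P.toLinearMap (P.root (g.indexEquiv i)) mu := by
  have h := RootPairing.Hom.weight_coweight_transpose_apply P P mu g.toHom
  have h' := LinearMap.congr_fun h (P.root i)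
  have h2 := RootPairing.Hom.root_weightMap_apply P P i g.toHom
  simp only [LinearMap.dualMap_apply] at h'
  rw [h2] at h'
  exact h'.symm

lemma coreflection_mem_weylOrbit {mu nu : Y} (h : nu ∈ weylOrbit P mu) (j : ι) :
    P.coreflection j nu ∈ weylOrbit P mu := by
  obtain ⟨g, rfl⟩ := h
  exact ⟨⟨MulOpposite.op (RootPairing.Equiv.reflection P j), P.reflection_mem_weylGroup j⟩ * g,
    mul_smul _ _ _⟩

/-- Every Weyl group orbit of coweights contains a dominant coweight. -/
theorem exists_isDominant_mem_weylOrbit [Finite ι] [P.IsReduced] (b : P.Base) (mu : Y) :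
    ∃ nu ∈ weylOrbit P mu, IsDominant b nu := by
  classical
  have := Fintype.ofFinite ι
  let f : Y → ℤ := fun nu ↦ ∑ i with b.IsPos i, P.toLinearMap (P.root i) nu
  have hbdd : ∀ nu ∈ weylOrbit P mu, f nu ≤ ∑ i : ι, |P.toLinearMap (P.root i) mu| := by
    rintro _ ⟨⟨g, hg⟩, rfl⟩
    obtain ⟨g, rfl⟩ := MulOpposite.op_surjective g
    calc f (MulOpposite.op g • mu)
        = ∑ i with b.IsPos i, P.toLinearMap (P.root (g.indexEquiv i)) mu :=
          Finset.sum_congr rfl fun i _ ↦ pairing_op_smul g i mu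
      _ ≤ ∑ i with b.IsPos i, |P.toLinearMap (P.root (g.indexEquiv i)) mu| :=
          Finset.sum_le_sum fun i _ ↦ le_abs_self _
      _ ≤ ∑ i : ι, |P.toLinearMap (P.root (g.indexEquiv i)) mu| :=
          Finset.sum_le_sum_of_subset_of_nonneg (Finset.filter_subset _ _)
            fun _ _ _ ↦ abs_nonneg _
      _ = _ := g.indexEquiv.sum_comp fun i ↦ |P.toLinearMap (P.root i) mu|
  obtain ⟨m, ⟨nu, hnu, rfl⟩, hmax⟩ := Int.exists_greatest_of_bdd
    (P := fun z ↦ ∃ nu ∈ weylOrbit P mu, f nu = z)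
    ⟨_, by rintro _ ⟨nu, hnu, rfl⟩; exact hbdd nu hnu⟩
    ⟨f mu, mu, MulAction.mem_orbit_self mu, rfl⟩
  have hsimple : ∀ j ∈ b.support, 0 ≤ P.toLinearMap (P.root j) nu := by
    intro j hj
    have hle := hmax _ ⟨_, coreflection_mem_weylOrbit hnu j, rfl⟩
    have hjpos : j ∈ ({i | b.IsPos i} : Finset ι) := by
      simpa using RootPairing.Base.isPos_of_mem_support hj
    have key : ∀ i, P.toLinearMap (P.root i) (P.coreflection j nu)
        = P.toLinearMap (P.root (P.reflectionPerm j i)) nu := fun i ↦ by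
      rw [← P.reflectionPerm_root, P.coreflection_apply]
      simp [mul_comm]
    have hf : f (P.coreflection j nu) = f nu - 2 * P.toLinearMap (P.root j) nu := by
      simp only [f]
      rw [← Finset.add_sum_erase _ _ hjpos, ← Finset.add_sum_erase _ _ hjpos]
      have hperm : ∑ i ∈ ({i | b.IsPos i} : Finset ι).erase j,
            P.toLinearMap (P.root i) (P.coreflection j nu)
          = ∑ i ∈ ({i | b.IsPos i} : Finset ι).erase j, P.toLinearMap (P.root i) nu := by
        have hmem : ∀ i ∈ ({i | b.IsPos i} : Finset ι).erase j,
            P.reflectionPerm j i ∈ ({i | b.IsPos i} : Finset ι).erase j := by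
          intro i hi
          simp only [Finset.mem_erase, Finset.mem_filter, Finset.mem_univ, true_and] at hi ⊢
          refine ⟨fun h ↦ ?_, hi.2.reflectionPerm hj hi.1⟩
          have hneg : i = P.reflectionPerm j j := by
            have h' := congrArg (P.reflectionPerm j) h
            simpa only [P.reflectionPerm_self] using h'
          let _ := P.indexNeg
          rw [hneg] at hi
          exact (RootPairing.Base.IsPos.neg_iff_not b j).mp hi.2
            (RootPairing.Base.isPos_of_mem_support hj)
        exact Finset.sum_nbij' (P.reflectionPerm j) (P.reflectionPerm j) hmem hmem
          (by simp) (by simp) (fun i _ ↦ key i)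
      rw [hperm, key, ← P.reflectionPerm_root, P.root_coroot_two]
      simp
      ring
    linarith
  refine ⟨nu, hnu, fun i hi ↦ ?_⟩
  refine hi.induction_on_add hsimple fun i j k hk hi hj ↦ ?_
  rw [hk, map_add, LinearMap.add_apply]
  exact add_nonneg hi (hsimple j hj)

/-- The dominant representative `mu⁺` of the Weyl group orbit of `mu`. -/
noncomputable def dominantRep [Finite ι] [P.IsReduced] (b : P.Base) (mu : Y) : Y :=
  (exists_isDominant_mem_weylOrbit b mu).choose

theorem dominantRep_mem_weylOrbit [Finite ι] [P.IsReduced] (b : P.Base) (mu : Y) :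
    dominantRep b mu ∈ weylOrbit P mu :=
  (exists_isDominant_mem_weylOrbit b mu).choose_spec.1

theorem isDominant_dominantRep [Finite ι] [P.IsReduced] (b : P.Base) (mu : Y) :
    IsDominant b (dominantRep b mu) :=
  (exists_isDominant_mem_weylOrbit b mu).choose_spec.2

end RootDatum

namespace RootDatum

variable {ι X Y : Type*} [AddCommGroup X] [AddCommGroup Y] {P : RootDatum ι X Y}

/-! (1) ⇒ (2): let `lam` be dominant with `mu ≤ lam`. If `mu` is not dominant, some simple root
takes the value `-1` on it, so the simple reflection just adds that coroot. The result stays below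
`lam` (`exists_add_coroot_sum`) and still satisfies (1), since the reflection permutes the other
positive roots. Iterating yields `mu⁺ ≤ lam`, and antisymmetry concludes.

(2) ⇒ (1): if a positive root is below `-1` on `mu`, test (2) on the dominant representative of `mu`
plus its coroot. It lies above `mu`, and below `mu⁺` because a dominant coweight is the maximum of
its orbit. It differs from `mu⁺`: the Weyl-invariant sum of squared root values drops strictly
inside a root string. -/

lemma pairing_coreflection (i j : ι) (y : Y) :
    P.toLinearMap (P.root i) (P.coreflection j y) =
      P.toLinearMap (P.root (P.reflectionPerm j i)) y := by
  rw [← P.reflectionPerm_root, P.coreflection_apply]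
  simp [mul_comm]

lemma coreflection_eq_sub (j : ι) (y : Y) :
    P.coreflection j y = y - P.toLinearMap (P.root j) y • P.coroot j :=
  P.coreflection_apply j y

/-! ### The dominance order -/

namespace DominanceLE

variable {b : P.Base} {x y z : Y}

lemma trans (hxy : DominanceLE b x y) (hyz : DominanceLE b y z) : DominanceLE b x z := by
  unfold DominanceLE at *
  simpa using add_mem hyz hxy

lemma exists_eq_add_sum (h : DominanceLE b x y) :
    ∃ c : ι → ℕ, y = x + ∑ i ∈ b.support, c i • P.coroot i := by
  classical
  unfold DominanceLE at h
  suffices H : ∀ v ∈ AddSubmonoid.closure (P.coroot '' b.support),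
      ∃ c : ι → ℕ, v = ∑ i ∈ b.support, c i • P.coroot i by
    obtain ⟨c, hc⟩ := H _ h
    exact ⟨c, by rw [← hc]; abel⟩
  intro v hv
  induction hv using AddSubmonoid.closure_induction with
  | mem v hv =>
    obtain ⟨j, hj, rfl⟩ := hv
    exact ⟨Pi.single j 1, by
      rw [Finset.sum_eq_single_of_mem j hj (fun i _ hij ↦ by simp [hij])]; simp⟩
  | zero => exact ⟨0, by simp⟩
  | add v w _ _ hv hw =>
    obtain ⟨c, rfl⟩ := hv
    obtain ⟨d, rfl⟩ := hw
    exact ⟨c + d, by simp [add_smul, Finset.sum_add_distrib]⟩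

/-- Simple coroots are linearly independent, so natural coefficients that cancel must vanish. -/
lemma antisymm (hxy : DominanceLE b x y) (hyx : DominanceLE b y x) : x = y := by
  obtain ⟨c, hc⟩ := hxy.exists_eq_add_sum
  obtain ⟨d, hd⟩ := hyx.exists_eq_add_sum
  have hsum : ∑ i ∈ b.support, ((c i + d i : ℕ) : ℤ) • P.coroot i = 0 := by
    simp only [natCast_zsmul, add_smul, Finset.sum_add_distrib]
    rw [hc, add_assoc] at hd
    exact left_eq_add.mp hd
  have h0 := linearIndepOn_finset_iff.mp b.linearIndepOn_coroot _ hsum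
  rw [hc, Finset.sum_eq_zero, add_zero]
  intro i hi
  have : c i = 0 := by have := h0 i hi; lia
  simp [this]

lemma add_nsmul_of_mem {v : Y} (hv : v ∈ AddSubmonoid.closure (P.coroot '' b.support)) (n : ℕ) :
    DominanceLE b x (x + n • v) := by
  unfold DominanceLE
  simpa using nsmul_mem hv n

end DominanceLE

/-! ### Positive roots and positive coroots -/

section Positive

lemma isPos_reflectionPerm_self_iff (b : P.Base) (i : ι) :
    b.IsPos (P.reflectionPerm i i) ↔ ¬ b.IsPos i := by
  let _ := P.indexNeg
  exact RootPairing.Base.IsPos.neg_iff_not b i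

variable [Finite ι]

lemma IsDominant.of_forall_mem_support {b : P.Base} {y : Y}
    (h : ∀ j ∈ b.support, 0 ≤ P.toLinearMap (P.root j) y) : IsDominant b y := by
  intro i hi
  refine hi.induction_on_add h fun i j k hk hi hj ↦ ?_
  rw [hk, map_add, LinearMap.add_apply]
  exact add_nonneg hi (h j hj)

/-- If a simple root is smaller on `x` than on `y ≥ x`, then its coroot can be added to `x`. -/
lemma exists_add_coroot_sum {b : P.Base} {x y : Y} {c : ι → ℕ}
    (hy : y = x + ∑ i ∈ b.support, c i • P.coroot i) {j : ι} (hj : j ∈ b.support)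
    (hlt : P.toLinearMap (P.root j) x < P.toLinearMap (P.root j) y) :
    ∃ d : ι → ℕ, y = x + P.coroot j + ∑ i ∈ b.support, d i • P.coroot i ∧
      ∑ i ∈ b.support, d i < ∑ i ∈ b.support, c i := by
  classical
  -- Distinct simple roots and coroots pair non-positively, so only the `j` term can raise the value
  -- of root `j`.
  have hcj : c j ≠ 0 := by
    intro h0
    have hle : ∑ i ∈ b.support, (c i : ℤ) * P.pairing j i ≤ 0 := by
      refine Finset.sum_nonpos fun i hi ↦ ?_
      by_cases hij : j = i
      · simp [← hij, h0]
      · have := b.pairingIn_le_zero_of_ne hij hj hi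
        have h2 : P.pairing j i ≤ 0 := by
          rw [← P.algebraMap_pairingIn ℤ]; simpa using this
        exact mul_nonpos_of_nonneg_of_nonpos (by positivity) h2
    rw [hy, map_add, map_sum] at hlt
    simp only [map_nsmul, RootPairing.root_coroot_eq_pairing, nsmul_eq_mul] at hlt
    lia
  refine ⟨Function.update c j (c j - 1), ?_, ?_⟩
  · rw [hy, add_assoc, ← Finset.add_sum_erase _ _ hj, ← Finset.add_sum_erase _ _ hj]
    have : ∑ i ∈ b.support.erase j, Function.update c j (c j - 1) i • P.coroot i =
        ∑ i ∈ b.support.erase j, c i • P.coroot i :=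
      Finset.sum_congr rfl fun i hi ↦ by rw [Function.update_of_ne (Finset.ne_of_mem_erase hi)]
    rw [this, Function.update_self, ← add_assoc (P.coroot j), ← succ_nsmul',
      Nat.sub_add_cancel (Nat.one_le_iff_ne_zero.mpr hcj)]
  · refine Finset.sum_lt_sum (fun i _ ↦ ?_) ⟨j, hj, by rw [Function.update_self]; lia⟩
    by_cases hij : i = j
    · subst hij; simp
    · simp [hij]

variable [P.IsReduced] (b : P.Base)

/-- The only positive root made negative by a simple reflection is the simple root itself. -/
lemma isPos_reflectionPerm_iff {i j : ι} (hj : j ∈ b.support) (hij : i ≠ j)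
    (hij' : i ≠ P.reflectionPerm j j) : b.IsPos (P.reflectionPerm j i) ↔ b.IsPos i := by
  refine ⟨fun h ↦ ?_, fun h ↦ h.reflectionPerm hj hij⟩
  have hne : P.reflectionPerm j i ≠ j := fun h' ↦ hij' (by
    simpa using congrArg (P.reflectionPerm j) h')
  simpa using h.reflectionPerm hj hne

/-- A root is positive if and only if the corresponding coroot is. -/
lemma isPos_iff_isPos_flip (i : ι) : b.IsPos i ↔ b.flip.IsPos i := by
  have : Module.IsReflexive ℤ Y := .of_isPerfPair P.toLinearMap.flip
  have : Module.IsReflexive ℤ X := .of_isPerfPair P.toLinearMap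
  have : P.flip.IsReduced := RootPairing.instFlipIsReduced P
  have hself : ∀ i, (b.IsPos i ↔ b.flip.IsPos i) →
      (b.IsPos (P.reflectionPerm i i) ↔ b.flip.IsPos (P.reflectionPerm i i)) := fun i hi ↦ by
    have h := isPos_reflectionPerm_self_iff (P := P.flip) b.flip i
    rw [isPos_reflectionPerm_self_iff, hi]
    exact h.symm
  have hsimple : ∀ i ∈ b.support, (b.IsPos i ↔ b.flip.IsPos i) := fun i hi ↦
    iff_of_true (RootPairing.Base.isPos_of_mem_support hi)
      (RootPairing.Base.isPos_of_mem_support (b := b.flip) hi)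
  -- Both notions of positivity hold on simple indices, switch under negation, and survive simple
  -- reflections away from `±j`.
  refine b.induction_reflect i hself hsimple fun i j hi hj ↦ ?_
  by_cases hij : i = j
  · subst hij; exact hself i hi
  by_cases hij' : i = P.reflectionPerm j j
  · rw [hij', P.reflectionPerm_self]; exact hsimple j hj
  have h := isPos_reflectionPerm_iff (P := P.flip) b.flip hj hij hij'
  rw [isPos_reflectionPerm_iff b hj hij hij', hi]
  exact h.symm

lemma coroot_mem_closure_of_isPos {i : ι} (hi : b.IsPos i) :
    P.coroot i ∈ AddSubmonoid.closure (P.coroot '' b.support) := by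
  refine ((isPos_iff_isPos_flip b i).mp hi).induction_on_add
    (p := fun i ↦ P.coroot i ∈ AddSubmonoid.closure (P.coroot '' b.support))
    (fun i hi ↦ AddSubmonoid.subset_closure ⟨i, hi, rfl⟩) fun i j k hk hi hj ↦ ?_
  have hk' : P.coroot k = P.coroot i + P.coroot j := hk
  rw [hk']
  exact add_mem hi (AddSubmonoid.subset_closure ⟨j, hj, rfl⟩)

end Positive

/-! ### Words in simple coreflections -/

/-- The composite of the coreflections in a list of indices. -/
def coreflectionWord (P : RootDatum ι X Y) (l : List ι) (y : Y) : Y :=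
  l.foldr (fun i z ↦ P.coreflection i z) y

@[simp] lemma coreflectionWord_nil (y : Y) : coreflectionWord P [] y = y := rfl

@[simp] lemma coreflectionWord_cons (i : ι) (l : List ι) (y : Y) :
    coreflectionWord P (i :: l) y = P.coreflection i (coreflectionWord P l y) := rfl

lemma coreflectionWord_append (l m : List ι) (y : Y) :
    coreflectionWord P (l ++ m) y = coreflectionWord P l (coreflectionWord P m y) := by
  simp [coreflectionWord]

lemma coreflection_reflectionPerm_apply (i j : ι) (y : Y) :
    P.coreflection (P.reflectionPerm j i) y =
      P.coreflection j (P.coreflection i (P.coreflection j y)) := by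
  exact congrArg (fun e ↦ e y) (RootPairing.reflection_reflectionPerm P.flip (i := i) (j := j))

section Words

variable [Finite ι] [P.IsReduced] (b : P.Base)

lemma exists_coreflectionWord_eq_coreflection (i : ι) :
    ∃ l : List ι, (∀ j ∈ l, j ∈ b.support) ∧
      ∀ y, P.coreflection i y = coreflectionWord P l y := by
  refine b.induction_reflect i (p := fun i ↦ ∃ l : List ι, (∀ j ∈ l, j ∈ b.support) ∧
    ∀ y, P.coreflection i y = coreflectionWord P l y) ?_
    (fun i hi ↦ ⟨[i], by simpa using hi, fun _ ↦ rfl⟩) ?_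
  · rintro i ⟨l, hl, h⟩
    exact ⟨l, hl, fun y ↦ by rw [coreflection_reflectionPerm_apply, P.coreflection_same, h]⟩
  · rintro i j ⟨l, hl, h⟩ hj
    refine ⟨j :: (l ++ [j]), ?_, fun y ↦ ?_⟩
    · intro k hk
      simp only [List.mem_cons, List.mem_append, List.not_mem_nil, or_false] at hk
      rcases hk with rfl | hk | rfl
      exacts [hj, hl k hk, hj]
    · rw [coreflection_reflectionPerm_apply, coreflectionWord_cons, coreflectionWord_append, h]
      rfl

/-- The Weyl group is generated by simple reflections. -/
lemma exists_coreflectionWord_of_mem_weylOrbit {x y : Y} (h : y ∈ weylOrbit P x) :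
    ∃ l : List ι, (∀ j ∈ l, j ∈ b.support) ∧ y = coreflectionWord P l x := by
  obtain ⟨⟨g, hg⟩, rfl⟩ := h
  obtain ⟨g, rfl⟩ := MulOpposite.op_surjective g
  have hg' : g ∈ P.weylGroup := hg
  suffices H : ∃ l : List ι, (∀ j ∈ l, j ∈ b.support) ∧
      ∀ z : Y, MulOpposite.op g • z = coreflectionWord P l z by
    obtain ⟨l, hl, h⟩ := H
    exact ⟨l, hl, h x⟩
  clear hg
  induction hg' using RootPairing.weylGroup.induction with
  | mem i => exact exists_coreflectionWord_eq_coreflection b i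
  | one => exact ⟨[], by simp, fun z ↦ by simp⟩
  | mul g h _ _ hg hh =>
    obtain ⟨l, hl, hg⟩ := hg
    obtain ⟨m, hm, hh⟩ := hh
    refine ⟨m ++ l, fun j hj ↦ (List.mem_append.mp hj).elim (hm j) (hl j), fun z ↦ ?_⟩
    rw [coreflectionWord_append, ← hg, ← hh, MulOpposite.op_mul, mul_smul]

/-- The exchange property: a word in simple coreflections taking a dominant coweight to the
negative side of a positive root may be shortened when multiplied by the reflection in that
root. -/
lemma exists_shorter_coreflectionWord {x : Y} (hx : IsDominant b x) {l : List ι}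
    (hl : ∀ j ∈ l, j ∈ b.support) {i : ι} (hi : b.IsPos i)
    (hneg : P.toLinearMap (P.root i) (coreflectionWord P l x) < 0) :
    ∃ m : List ι, (∀ j ∈ m, j ∈ b.support) ∧ m.length < l.length ∧
      P.coreflection i (coreflectionWord P l x) = coreflectionWord P m x := by
  induction l generalizing i with
  | nil => exact absurd (hx i hi) (not_le.mpr hneg)
  | cons t l ih =>
    have ht : t ∈ b.support := hl t (by simp)
    have hl' : ∀ j ∈ l, j ∈ b.support := fun j hj ↦ hl j (by simp [hj])
    -- Either the first letter cancels, or `s_t` keeps `i` positive and the shortening happens in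
    -- the tail.
    by_cases hit : i = t
    · subst hit
      exact ⟨l, hl', by simp, by simp⟩
    · rw [coreflectionWord_cons, pairing_coreflection] at hneg
      obtain ⟨m, hm, hlen, h⟩ := ih hl' (hi.reflectionPerm ht hit) hneg
      refine ⟨t :: m, ?_, by simpa using hlen, ?_⟩
      · intro j hj
        rcases List.mem_cons.mp hj with rfl | hj
        exacts [ht, hm j hj]
      · rw [coreflectionWord_cons, coreflectionWord_cons, ← h, coreflection_reflectionPerm_apply,
          P.coreflection_same]

/-- Strong induction on length: the first letter either lowers the coweight given by the tail, or
the exchange property replaces the whole word by a shorter one. -/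
lemma coreflectionWord_dominanceLE {x : Y} (hx : IsDominant b x) (n : ℕ) (l : List ι)
    (hl : ∀ j ∈ l, j ∈ b.support) (hn : l.length = n) :
    DominanceLE b (coreflectionWord P l x) x := by
  induction n using Nat.strong_induction_on generalizing l with
  | _ n ih =>
  match l, hl with
  | [], _ => simp [DominanceLE]
  | t :: l, hl =>
    have ht : t ∈ b.support := hl t (by simp)
    have hl' : ∀ j ∈ l, j ∈ b.support := fun j hj ↦ hl j (by simp [hj])
    rw [List.length_cons] at hn
    rw [coreflectionWord_cons]
    rcases le_or_gt 0 (P.toLinearMap (P.root t) (coreflectionWord P l x)) with hle | hlt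
    · refine DominanceLE.trans ?_ (ih l.length (by lia) l hl' rfl)
      obtain ⟨k, hk⟩ := Int.eq_ofNat_of_zero_le hle
      have := DominanceLE.add_nsmul_of_mem (x := P.coreflection t (coreflectionWord P l x))
        (AddSubmonoid.subset_closure ⟨t, ht, rfl⟩ :
          P.coroot t ∈ AddSubmonoid.closure (P.coroot '' b.support)) k
      rwa [coreflection_eq_sub, hk, natCast_zsmul, sub_add_cancel, ← natCast_zsmul, ← hk,
        ← coreflection_eq_sub] at this
    · obtain ⟨m, hm, hlen, h⟩ := exists_shorter_coreflectionWord b hx hl'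
        (RootPairing.Base.isPos_of_mem_support ht) hlt
      rw [h]
      exact ih m.length (by lia) m hm rfl

/-- A dominant coweight is the largest element of its Weyl group orbit. -/
theorem IsDominant.dominanceLE_of_mem_weylOrbit {b : P.Base} {x y : Y} (hx : IsDominant b x)
    (hy : y ∈ weylOrbit P x) : DominanceLE b y x := by
  obtain ⟨l, hl, rfl⟩ := exists_coreflectionWord_of_mem_weylOrbit b hy
  exact coreflectionWord_dominanceLE b hx _ l hl rfl

lemma dominanceLE_dominantRep {x y : Y} (hy : y ∈ weylOrbit P x) :
    DominanceLE b y (dominantRep b x) := by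
  refine (isDominant_dominantRep b x).dominanceLE_of_mem_weylOrbit ?_
  have h := dominantRep_mem_weylOrbit b x
  unfold weylOrbit at *
  rwa [MulAction.orbit_eq_iff.mpr h]

end Words

/-! ### An invariant quadratic form -/

section SumSq

variable [Fintype ι]

lemma sum_sq_pairing_eq_of_mem_weylOrbit {x y : Y} (h : y ∈ weylOrbit P x) :
    ∑ i, P.toLinearMap (P.root i) y ^ 2 = ∑ i, P.toLinearMap (P.root i) x ^ 2 := by
  obtain ⟨⟨g, hg⟩, rfl⟩ := h
  obtain ⟨g, rfl⟩ := MulOpposite.op_surjective g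
  rw [← g.indexEquiv.sum_comp fun i ↦ P.toLinearMap (P.root i) x ^ 2]
  exact Finset.sum_congr rfl fun i _ ↦ congrArg (· ^ 2) (pairing_op_smul g i x)

/-- Along `x + t • P.coroot i` the form is a strictly convex quadratic in `t`, with equal values at
`0` and `-k` by reflection invariance; `1` lies strictly between. -/
lemma sum_sq_pairing_add_coroot_lt {x : Y} {i : ι} (h : P.toLinearMap (P.root i) x < -1) :
    ∑ j, P.toLinearMap (P.root j) (x + P.coroot i) ^ 2 <
      ∑ j, P.toLinearMap (P.root j) x ^ 2 := by
  set k := P.toLinearMap (P.root i) x with hk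
  have hexp : ∀ t : ℤ, ∑ j, P.toLinearMap (P.root j) (x + t • P.coroot i) ^ 2 =
      ∑ j, P.toLinearMap (P.root j) x ^ 2 +
        t * (2 * ∑ j, P.toLinearMap (P.root j) x * P.pairing j i) +
        t ^ 2 * ∑ j, P.pairing j i ^ 2 := fun t ↦ by
    simp only [Finset.mul_sum, ← Finset.sum_add_distrib]
    refine Finset.sum_congr rfl fun j _ ↦ ?_
    simp only [map_add, map_zsmul, RootPairing.root_coroot_eq_pairing, smul_eq_mul]
    ring
  have hpos : 0 < ∑ j, P.pairing j i ^ 2 :=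
    Finset.sum_pos' (fun j _ ↦ sq_nonneg _) ⟨i, Finset.mem_univ i, by simp⟩
  have hrefl : x + (-k) • P.coroot i ∈ weylOrbit P x := by
    have := coreflection_mem_weylOrbit (P := P) (MulAction.mem_orbit_self x) i
    rwa [coreflection_eq_sub, ← hk, sub_eq_add_neg, ← neg_smul] at this
  have h1 := hexp 1
  have h2 := hexp (-k)
  rw [sum_sq_pairing_eq_of_mem_weylOrbit hrefl] at h2
  rw [one_smul] at h1
  have h3 : 2 * ∑ j, P.toLinearMap (P.root j) x * P.pairing j i = k * ∑ j, P.pairing j i ^ 2 := by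
    have hk0 : -k ≠ 0 := by lia
    apply mul_left_cancel₀ hk0
    linear_combination -h2
  rw [h1, h3]
  nlinarith

end SumSq

/-! ### The two implications -/

section Main

variable [Finite ι] [P.IsReduced] (b : P.Base)

/-- If all positive roots are at least `-1` on `x`, every dominant coweight above `x` is above
the dominant representative of its orbit. -/
lemma dominantRep_dominanceLE_of_forall_neg_one_le {y mu : Y} (hy : IsDominant b y) (n : ℕ)
    (x : Y) (c : ι → ℕ) (hc : y = x + ∑ i ∈ b.support, c i • P.coroot i)
    (hn : ∑ i ∈ b.support, c i = n) (hmem : x ∈ weylOrbit P mu)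
    (hx : ∀ i, b.IsPos i → -1 ≤ P.toLinearMap (P.root i) x) :
    DominanceLE b (dominantRep b mu) y := by
  induction n using Nat.strong_induction_on generalizing x c with
  | _ n ih =>
  by_cases hdom : ∀ j ∈ b.support, 0 ≤ P.toLinearMap (P.root j) x
  · have h1 : DominanceLE b (dominantRep b mu) x := by
      refine (IsDominant.of_forall_mem_support hdom).dominanceLE_of_mem_weylOrbit ?_
      have h := dominantRep_mem_weylOrbit b mu
      unfold weylOrbit at *
      rwa [MulAction.orbit_eq_iff.mpr hmem]
    refine h1.trans ?_
    unfold DominanceLE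
    rw [hc, add_sub_cancel_left]
    exact sum_mem fun i hi ↦
      nsmul_mem (AddSubmonoid.subset_closure (Set.mem_image_of_mem P.coroot hi)) _
  · push Not at hdom
    obtain ⟨j, hj, hneg⟩ := hdom
    have hjpos := RootPairing.Base.isPos_of_mem_support (b := b) hj
    have hj1 : P.toLinearMap (P.root j) x = -1 := le_antisymm (by lia) (hx j hjpos)
    have hrefl : P.coreflection j x = x + P.coroot j := by
      rw [coreflection_eq_sub, hj1, neg_smul, one_smul, sub_neg_eq_add]
    obtain ⟨d, hd, hlt⟩ := exists_add_coroot_sum hc hj (hneg.trans_le (hy j hjpos))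
    refine ih _ (hn ▸ hlt) (x + P.coroot j) d hd rfl
      (hrefl ▸ coreflection_mem_weylOrbit hmem j) fun i hi ↦ ?_
    by_cases hij : i = j
    · subst hij
      rw [map_add, hj1, P.root_coroot_two]
      norm_num
    · rw [← hrefl, pairing_coreflection]
      exact hx _ (hi.reflectionPerm hj hij)

/-- Moving strictly inside a root string lowers the dominant representative. -/
lemma dominantRep_add_coroot_dominanceLE {mu : Y} {i : ι}
    (hi : P.toLinearMap (P.root i) mu ≤ -1) :
    DominanceLE b (dominantRep b (mu + P.coroot i)) (dominantRep b mu) := by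
  obtain ⟨w, hw⟩ := dominantRep_mem_weylOrbit b (mu + P.coroot i)
  have hw' : w • (mu + P.coroot i) = dominantRep b (mu + P.coroot i) := hw
  have hcoroot : ∃ j, w • P.coroot i = P.coroot j := by
    obtain ⟨g, hg⟩ := w
    obtain ⟨g, rfl⟩ := MulOpposite.op_surjective g
    exact ⟨_, RootPairing.Hom.coroot_coweightMap_apply P P i g.toHom⟩
  obtain ⟨j, hj⟩ := hcoroot
  rw [smul_add, hj] at hw'
  rw [← hw']
  have hmem : ∀ y ∈ weylOrbit P mu, DominanceLE b (w • y) (dominantRep b mu) := fun y hy ↦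
    dominanceLE_dominantRep b (MulAction.mem_orbit_of_mem_orbit w hy)
  -- The point lies on the string from `w • mu` to `w • s_i mu`; the sign of coroot `j` decides
  -- which end dominates it.
  rcases b.coroot_mem_or_neg_mem j with hpos | hneg
  · obtain ⟨k, hk⟩ := Int.eq_ofNat_of_zero_le (a := -P.toLinearMap (P.root i) mu - 1) (by lia)
    have h1 := hmem _ (coreflection_mem_weylOrbit (MulAction.mem_orbit_self mu) i)
    have h2 : P.coreflection i mu = mu + P.coroot i + k • P.coroot i := by
      rw [coreflection_eq_sub, ← natCast_zsmul, show P.toLinearMap (P.root i) mu = -(k + 1) by lia]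
      module
    rw [h2, smul_add, smul_add, smul_comm w k, hj] at h1
    exact (DominanceLE.add_nsmul_of_mem hpos k).trans h1
  · have h1 := DominanceLE.add_nsmul_of_mem (x := w • mu + P.coroot j) hneg 1
    rw [one_smul, add_neg_cancel_right] at h1
    exact h1.trans (hmem mu (MulAction.mem_orbit_self mu))

end Main

end RootDatum

theorem mainTheorem11 {ι X Y : Type*} [Finite ι] [AddCommGroup X] [Module.Finite ℤ X]
    [AddCommGroup Y] [Module.Finite ℤ Y] (P : RootDatum ι X Y) [P.IsReduced] (b : P.Base)
    (mu : Y) :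
    (∀ i, b.IsPos i → -1 ≤ P.toLinearMap (P.root i) mu) ↔
      (∀ lam : Y, RootDatum.IsDominant b lam → RootDatum.DominanceLE b mu lam →
        RootDatum.DominanceLE b lam (RootDatum.dominantRep b mu) →
          lam = RootDatum.dominantRep b mu) := by
  open RootDatum in
  refine ⟨fun h lam hlam hmu hle ↦ ?_, fun h i hi ↦ ?_⟩
  · obtain ⟨c, hc⟩ := hmu.exists_eq_add_sum
    exact hle.antisymm (dominantRep_dominanceLE_of_forall_neg_one_le b hlam _ mu c hc rfl
      (MulAction.mem_orbit_self mu) h)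
  · by_contra! hlt
    have := Fintype.ofFinite ι
    have heq := h (dominantRep b (mu + P.coroot i)) (isDominant_dominantRep b _)
      (DominanceLE.trans
        (by simpa using DominanceLE.add_nsmul_of_mem (coroot_mem_closure_of_isPos b hi) 1)
        (dominanceLE_dominantRep b (MulAction.mem_orbit_self _)))
      (dominantRep_add_coroot_dominanceLE b hlt.le)
    have h1 := sum_sq_pairing_eq_of_mem_weylOrbit (dominantRep_mem_weylOrbit b (mu + P.coroot i))
    rw [heq, sum_sq_pairing_eq_of_mem_weylOrbit (dominantRep_mem_weylOrbit b mu)] at h1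
    exact (sum_sq_pairing_add_coroot_lt hlt).ne' h1
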